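/- Let $G$ be a (finite-dimensional, real, smooth) Lie group with identity $e$ and Lie algebra $\mathfrak g=T_eG$, let $g$ be a bi-invariant Riemannian metric on $G$, let $\tilde X$ be a left-invariant vector field on $G$, and put $X=\tilde X(e)$, $\langle\cdot,\cdot\rangle=g_e$. Let $$F(x,y)=\frac{\alpha(x,y)^2}{\beta(x,y)},\qquad \alpha(x,y)=\sqrt{g_x(y,y)},\quad \beta(x,y)=g_x(y,\tilde X(x)),$$ be the Kropina metric defined by $g$ and $\tilde X$ on the conic domain $\{\beta>0\}\subset TG$, and suppose that the Chern connection of $F$ coincides with the Levi-Civita connection of $g$. For linearly independent tangent vectors $Y,U$ at a point with $\beta(Y)>0$, let $$K(P,Y)=\frac{g_Y(R(U,Y)Y,U)}{g_Y(Y,Y)\,g_Y(U,U)-g_Y(Y,U)^2},\qquad P=\mathrm{span}\{Y,U\},$$ be the flag curvature of $F$, where $g_Y(U,V)=\frac12\frac{\partial^2}{\partial s\,\partial t}F^2(Y+sU+tV)\big|_{s=t=0}$ and $R$ is the curvature of the Chern connection of $F$, with the sign convention $R(U,V)W=\nabla_U\nabla_VW-\nabla_V\nabla_UW-\nabla_{[U,V]}W$.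 Then for all $Y,U\in\mathfrak g$ that are orthonormal with respect to $\langle\cdot,\cdot\rangle$ and satisfy $\langle Y,X\rangle>0$, the flag $(P,Y)$ with $P=\mathrm{span}\{Y,U\}$, and likewise its left translate to any point of $G$, has flag curvature $$K(P,Y)=\frac{-3\langle U,X\rangle\,\langle[[U,Y],Y],X\rangle-2\langle Y,X\rangle^{2}\,\langle[[U,Y],Y],U\rangle}{8\left(\frac{\langle U,X\rangle}{\langle Y,X\rangle}\right)^2+8}.$$ -/

import Mathlib

open scoped Manifold ContDiff Bundle
open Bundle

set_option maxSynthPendingDepth 3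

noncomputable section

namespace Kropina

/-! ### Finsler geometry in a coordinate domain

Here `L z y` is the expression of a (conic) Finsler metric in a chart with values in the vector
space `E`; `z` is the point and `y` the tangent vector, both in coordinates. -/

section Coordinates

variable {E : Type*} [NormedAddCommGroup E] [NormedSpace ℝ E]

/-- The fundamental tensor `g_{(z,y)}(u, v) = ½ ∂²/∂s∂t L²(z, y + s u + t v)` at `s = t = 0`, that is
`g_{ij} = ½ ∂²L²/∂yⁱ∂yʲ`. -/
def fundTensor (L : E → E → ℝ) (z y : E) : E →L[ℝ] E →L[ℝ] ℝ :=
  (1 / 2 : ℝ) • fderiv ℝ (fderiv ℝ (fun y' : E => L z y' ^ 2)) y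

/-- Given a nondegenerate bilinear form `h` and a trilinear form `D` (to be thought of as a derivative
`D w = ∂_w h`), the vector `c` with
`h(c, w) = ½ (D_u h (v, w) + D_v h (u, w) - D_w h (u, v))` for all `w`. -/
def koszul (h : E →L[ℝ] E →L[ℝ] ℝ) (D : E →L[ℝ] E →L[ℝ] E →L[ℝ] ℝ) (u v : E) : E :=
  h.inverse ((1 / 2 : ℝ) • (D u v + D v u - (D.flip u).flip v))

/-- The Christoffel symbols `γ(u, v) = γⁱ_{jk} uʲ vᵏ` at `z` of a field `h` of inner products. -/
def christoffel (h : E → E →L[ℝ] E →L[ℝ] ℝ) (z u v : E) : E :=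
  koszul (h z) (fderiv ℝ h z) u v

/-- The spray coefficients `½ γⁱ_{jk}(z, y) yʲ yᵏ`, where `γ` are the formal Christoffel symbols of
the fundamental tensor. -/
def spray (L : E → E → ℝ) (z y : E) : E :=
  (1 / 2 : ℝ) • christoffel (fun z' => fundTensor L z' y) z y y

/-- The nonlinear connection `Nⁱ_j(z, y)`, the derivative of the spray coefficients in `y`. -/
def nonlinearConn (L : E → E → ℝ) (z y : E) : E →L[ℝ] E :=
  fderiv ℝ (fun y' => spray L z y') y

/-- The horizontal derivatives `δ_k g_{ij} = ∂g_{ij}/∂zᵏ - Nᵐ_k ∂g_{ij}/∂yᵐ` of the fundamental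
tensor; the first argument is the direction of differentiation. -/
def horizDerivFund (L : E → E → ℝ) (z y : E) : E →L[ℝ] E →L[ℝ] E →L[ℝ] ℝ :=
  fderiv ℝ (fun z' => fundTensor L z' y) z -
    (fderiv ℝ (fun y' => fundTensor L z y') y).comp (nonlinearConn L z y)

/-- The coefficients of the Chern connection,
`Γⁱ_{jk} = ½ gⁱˢ (δ_j g_{sk} + δ_k g_{js} - δ_s g_{jk})`, contracted with `u` and `v`. -/
def chernCoeff (L : E → E → ℝ) (z y u v : E) : E :=
  koszul (fundTensor L z y) (horizDerivFund L z y) u v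

/-- The (horizontal) curvature `R(u, v) w` of the Chern connection with reference vector `y`:
`R_j{}ⁱ_{kl} = δ_k Γⁱ_{jl} - δ_l Γⁱ_{jk} + Γⁱ_{hk} Γʰ_{jl} - Γⁱ_{hl} Γʰ_{jk}`, contracted with
`wʲ uᵏ vˡ`; this is the expression of `∇_u ∇_v w - ∇_v ∇_u w - ∇_{[u,v]} w`. -/
def chernCurvature (L : E → E → ℝ) (z y u v w : E) : E :=
  (fderiv ℝ (fun z' => chernCoeff L z' y v w) z u
    - fderiv ℝ (fun y' => chernCoeff L z y' v w) y (nonlinearConn L z y u))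
  - (fderiv ℝ (fun z' => chernCoeff L z' y u w) z v
    - fderiv ℝ (fun y' => chernCoeff L z y' u w) y (nonlinearConn L z y v))
  + chernCoeff L z y u (chernCoeff L z y v w)
  - chernCoeff L z y v (chernCoeff L z y u w)

/-- The flag curvature of the flag with flagpole `y` and plane `span {y, u}`, in coordinates. -/
def flagCurvatureCoord (L : E → E → ℝ) (z y u : E) : ℝ :=
  fundTensor L z y (chernCurvature L z y u y y) u /
    (fundTensor L z y y y * fundTensor L z y u u - fundTensor L z y y u ^ 2)

end Coordinates

/-! ### Finsler and Riemannian metrics on a manifold -/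

section Manifold

variable {E : Type*} [NormedAddCommGroup E] [NormedSpace ℝ E]
  {M : Type*} [TopologicalSpace M] [ChartedSpace E M]

/-- The tangent vector at `φ⁻¹(z)` with coordinates `y`, where `φ` is the preferred chart at `x₀`. -/
def ofCoord (x₀ : M) (z : E) :
    E →L[ℝ] TangentSpace 𝓘(ℝ, E) ((extChartAt 𝓘(ℝ, E) x₀).symm z) :=
  mfderiv 𝓘(ℝ, E) 𝓘(ℝ, E) (extChartAt 𝓘(ℝ, E) x₀).symm z

/-- The coordinates of a tangent vector at `x`, in the preferred chart at `x₀`. -/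
def toCoord (x₀ x : M) : TangentSpace 𝓘(ℝ, E) x →L[ℝ] E :=
  mfderiv 𝓘(ℝ, E) 𝓘(ℝ, E) (extChartAt 𝓘(ℝ, E) x₀) x

/-- The expression of a Finsler metric in the preferred chart at `x₀`. -/
def finslerCoord (F : ∀ x : M, TangentSpace 𝓘(ℝ, E) x → ℝ) (x₀ : M) (z y : E) : ℝ :=
  F ((extChartAt 𝓘(ℝ, E) x₀).symm z) (ofCoord x₀ z y)

/-- The flag curvature `K(P, Y)` of a Finsler metric at `x`, for the flag with flagpole `Y` and
plane `P = span {Y, U}`. -/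
def flagCurvature (F : ∀ x : M, TangentSpace 𝓘(ℝ, E) x → ℝ) (x : M)
    (Y U : TangentSpace 𝓘(ℝ, E) x) : ℝ :=
  flagCurvatureCoord (finslerCoord F x) (extChartAt 𝓘(ℝ, E) x x) (toCoord x x Y) (toCoord x x U)

variable [IsManifold 𝓘(ℝ, E) ∞ M]

variable (E M) in
/-- Smooth Riemannian metrics on `M`. -/
abbrev RiemMetric : Type _ :=
  ContMDiffRiemannianMetric 𝓘(ℝ, E) ∞ E (fun x : M => TangentSpace 𝓘(ℝ, E) x)

/-- The expression of a Riemannian metric in the preferred chart at `x₀`. -/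
def metricCoord (g : RiemMetric E M) (x₀ : M) (z : E) : E →L[ℝ] E →L[ℝ] ℝ :=
  let B : E →L[ℝ] E →L[ℝ] ℝ := g.inner ((extChartAt 𝓘(ℝ, E) x₀).symm z)
  let A : E →L[ℝ] E := ofCoord x₀ z
  B.bilinearComp A A

/-- The Chern connection of `F`, which is a Finsler metric on the conic domain `D` of the tangent
bundle, coincides with the Levi-Civita connection of `g`: at every point of `D`, the connection
coefficients agree in every chart. -/
def ChernEqLeviCivita (F : ∀ x : M, TangentSpace 𝓘(ℝ, E) x → ℝ)
    (D : ∀ x : M, Set (TangentSpace 𝓘(ℝ, E) x)) (g : RiemMetric E M) : Prop :=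
  ∀ x₀ : M, ∀ z ∈ (extChartAt 𝓘(ℝ, E) x₀).target, ∀ y : E,
    ofCoord x₀ z y ∈ D ((extChartAt 𝓘(ℝ, E) x₀).symm z) →
    ∀ u v : E, chernCoeff (finslerCoord F x₀) z y u v = christoffel (metricCoord g x₀) z u v

/-- `α(x, y) = √(g_x(y, y))`. -/
def alpha (g : RiemMetric E M) (x : M) (y : TangentSpace 𝓘(ℝ, E) x) : ℝ :=
  Real.sqrt (g.inner x y y)

/-- `β(x, y) = g_x(y, V(x))`, the 1-form corresponding to the vector field `V`. -/
def beta (g : RiemMetric E M) (V : ∀ x : M, TangentSpace 𝓘(ℝ, E) x) (x : M)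
    (y : TangentSpace 𝓘(ℝ, E) x) : ℝ :=
  g.inner x y (V x)

/-- The Kropina metric `F = α² / β` defined by `g` and the vector field `V`. -/
def kropina (g : RiemMetric E M) (V : ∀ x : M, TangentSpace 𝓘(ℝ, E) x) (x : M)
    (y : TangentSpace 𝓘(ℝ, E) x) : ℝ :=
  alpha g x y ^ 2 / beta g V x y

/-- The domain `{β > 0}` of the Kropina metric. -/
def kropinaDomain (g : RiemMetric E M) (V : ∀ x : M, TangentSpace 𝓘(ℝ, E) x) (x : M) :
    Set (TangentSpace 𝓘(ℝ, E) x) :=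
  {y | 0 < beta g V x y}

end Manifold

/-! ### Invariant metrics and vector fields on a Lie group -/

section LieGroup

variable {E : Type*} [NormedAddCommGroup E] [NormedSpace ℝ E]
  {G : Type*} [TopologicalSpace G] [ChartedSpace E G] [Group G]

/-- The vector field `V` is left-invariant: `d(L_a)_b V(b) = V(ab)`. -/
def IsLeftInvariantField (V : ∀ x : G, TangentSpace 𝓘(ℝ, E) x) : Prop :=
  ∀ a b : G, mfderiv 𝓘(ℝ, E) 𝓘(ℝ, E) (fun x : G => a * x) b (V b) = V (a * b)

variable [IsManifold 𝓘(ℝ, E) ∞ G]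

/-- The Riemannian metric `g` is bi-invariant: left and right translations are isometries. -/
def IsBiInvariant (g : RiemMetric E G) : Prop :=
  (∀ (a b : G) (v w : TangentSpace 𝓘(ℝ, E) b),
    g.inner (a * b) (mfderiv 𝓘(ℝ, E) 𝓘(ℝ, E) (fun x : G => a * x) b v)
      (mfderiv 𝓘(ℝ, E) 𝓘(ℝ, E) (fun x : G => a * x) b w) = g.inner b v w) ∧
  (∀ (a b : G) (v w : TangentSpace 𝓘(ℝ, E) b),
    g.inner (b * a) (mfderiv 𝓘(ℝ, E) 𝓘(ℝ, E) (fun x : G => x * a) b v)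
      (mfderiv 𝓘(ℝ, E) 𝓘(ℝ, E) (fun x : G => x * a) b w) = g.inner b v w)

end LieGroup

end Kropina

end

noncomputable section

namespace Kropina

open VectorField Filter Topology

/-! ### Levi-Civita calculus in a coordinate domain. -/

section Coordinates

variable {E : Type*} [NormedAddCommGroup E] [NormedSpace ℝ E]

/-! The hypothesis on the connections makes the Chern coefficients independent of the flagpole, so
the Chern curvature is the Riemann curvature of the bi-invariant metric, and only the inner products
in the flag curvature remember the Kropina metric.

For the Riemannian half, left invariance makes pairings of left-invariant fields constant, and right
invariance makes these fields Killing, since they generate right translations. The Koszul formula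
then gives `∇_U V = ½ [U, V]` (`covDeriv_eq_lieBracket`), hence `R(U, Y) Y = -¼ [[U, Y], Y]`
(`riemannCoord_eq_lieBracket`).

For the Finsler half, two derivatives of `(α² / β)²` give the fundamental tensor
(`fundTensor_kropina`). Put `b = ⟨Y, X⟩`, `c = ⟨U, X⟩`, `r = [[U, Y], Y]`. Orthonormality and `⟨Y,
r⟩ = 0` give `g_Y(r, U) = 2⟨r, U⟩ / b² + 3c⟨r, X⟩ / b⁴` and the Gram determinant `2(b² + c²) / b⁶`;
their quotient times `-¼` is the stated value.

Everything is computed in the preferred chart at the point `a`, on chart expressions of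
left-invariant fields. -/

theorem apply_koszul {h : E →L[ℝ] E →L[ℝ] ℝ} (hh : h.IsInvertible)
    (D : E →L[ℝ] E →L[ℝ] E →L[ℝ] ℝ) (u v w : E) :
    h (koszul h D u v) w = (1 / 2 : ℝ) * (D u v w + D v u w - D w u v) := by
  rw [koszul, hh.self_apply_inverse]
  simp

theorem isInvertible_of_pos [FiniteDimensional ℝ E] {h : E →L[ℝ] E →L[ℝ] ℝ}
    (hpos : ∀ u, u ≠ 0 → 0 < h u u) : h.IsInvertible := by
  have hinj : Function.Injective (h : E →ₗ[ℝ] (E →L[ℝ] ℝ)) := by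
    rw [injective_iff_map_eq_zero]
    intro u hu
    by_contra hne
    have h0 : h u = 0 := hu
    have := hpos u hne
    rw [h0] at this
    exact lt_irrefl _ this
  have hdim : Module.finrank ℝ E = Module.finrank ℝ (E →L[ℝ] ℝ) := by
    rw [← (LinearMap.toContinuousLinearMap : (E →ₗ[ℝ] ℝ) ≃ₗ[ℝ] (E →L[ℝ] ℝ)).finrank_eq]
    exact Subspace.dual_finrank_eq.symm
  refine ⟨(LinearEquiv.ofInjectiveOfFinrankEq _ hinj hdim).toContinuousLinearEquiv, ?_⟩
  ext
  rfl

/-- `koszul`, as a continuous bilinear map. -/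
def koszulCLM (h : E →L[ℝ] E →L[ℝ] ℝ) (D : E →L[ℝ] E →L[ℝ] E →L[ℝ] ℝ) : E →L[ℝ] E →L[ℝ] E :=
  (ContinuousLinearMap.compL ℝ E (E →L[ℝ] ℝ) E h.inverse).comp
    ((1 / 2 : ℝ) • (D + D.flip -
      ((ContinuousLinearMap.flipₗᵢ ℝ E E ℝ : _ ≃ₗᵢ[ℝ] _) :
        (E →L[ℝ] E →L[ℝ] ℝ) →L[ℝ] (E →L[ℝ] E →L[ℝ] ℝ)).comp D.flip))

theorem fderiv_bilin_symm {h : E → E →L[ℝ] E →L[ℝ] ℝ} {z : E} (hd : DifferentiableAt ℝ h z)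
    (hs : ∀ᶠ z' in 𝓝 z, ∀ u v, h z' u v = h z' v u) (w u v : E) :
    fderiv ℝ h z w u v = fderiv ℝ h z w v u := by
  have key : ∀ u v, HasFDerivAt (fun z' => h z' u v)
      (((fderiv ℝ h z).flip u).flip v) z := fun u v => by
    have := (hd.hasFDerivAt.clm_apply (hasFDerivAt_const u z)).clm_apply (hasFDerivAt_const v z)
    refine this.congr_fderiv ?_
    ext w
    simp
  have h2 : HasFDerivAt (fun z' => h z' u v) (((fderiv ℝ h z).flip v).flip u) z :=
    (key v u).congr_of_eventuallyEq (hs.mono fun z' hz => hz u v)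
  have := congrArg (fun A => A w) ((key u v).unique h2)
  simpa using this

/-- Torsion-freeness, inherited from the symmetry of `h` near `z`. -/
theorem christoffel_symm {h : E → E →L[ℝ] E →L[ℝ] ℝ} {z : E} (hd : DifferentiableAt ℝ h z)
    (hs : ∀ᶠ z' in 𝓝 z, ∀ u v, h z' u v = h z' v u) (u v : E) :
    christoffel h z u v = christoffel h z v u := by
  rw [christoffel, christoffel, koszul, koszul]
  congr 2
  ext w
  simp [fderiv_bilin_symm hd hs w u v, add_comm]

/-- The Christoffel symbols of `h`, as a field of bilinear maps. -/
def christoffelCLM (h : E → E →L[ℝ] E →L[ℝ] ℝ) (z : E) : E →L[ℝ] E →L[ℝ] E :=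
  koszulCLM (h z) (fderiv ℝ h z)

theorem christoffelCLM_apply (h : E → E →L[ℝ] E →L[ℝ] ℝ) (z u v : E) :
    christoffelCLM h z u v = christoffel h z u v := rfl

theorem differentiableAt_christoffelCLM [CompleteSpace E] {h : E → E →L[ℝ] E →L[ℝ] ℝ} {z : E}
    (hd : ContDiffAt ℝ 2 h z) (hi : (h z).IsInvertible) :
    DifferentiableAt ℝ (christoffelCLM h) z := by
  have h1 : DifferentiableAt ℝ (fun z' => (h z').inverse) z :=
    ((hi.contDiffAt_map_inverse (n := 1)).differentiableAt one_ne_zero).comp z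
      (hd.differentiableAt two_ne_zero)
  have h2 : DifferentiableAt ℝ (fderiv ℝ h) z :=
    (hd.fderiv_right (m := 1) (by norm_num)).differentiableAt one_ne_zero
  have h3 : DifferentiableAt ℝ (fun z' => (fderiv ℝ h z').flip) z :=
    (ContinuousLinearMap.flipₗᵢ ℝ E E (E →L[ℝ] ℝ)).toContinuousLinearEquiv.differentiableAt.comp
      z h2
  unfold christoffelCLM koszulCLM
  refine DifferentiableAt.clm_comp ?_ ?_
  · exact (ContinuousLinearMap.compL ℝ E (E →L[ℝ] ℝ) E).differentiableAt.comp z h1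
  · have h4 := (differentiableAt_const (((ContinuousLinearMap.flipₗᵢ ℝ E E ℝ : _ ≃ₗᵢ[ℝ] _) :
        (E →L[ℝ] E →L[ℝ] ℝ) →L[ℝ] (E →L[ℝ] E →L[ℝ] ℝ)))).clm_comp h3
    exact DifferentiableAt.const_smul ((h2.add h3).sub h4) (1 / 2 : ℝ)

/-- The covariant derivative of the vector field `W` in the direction of `V`, for the Levi-Civita
connection of `h`. -/
def covDeriv (h : E → E →L[ℝ] E →L[ℝ] ℝ) (V W : E → E) (z : E) : E :=
  fderiv ℝ W z (V z) + christoffel h z (V z) (W z)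

theorem covDeriv_congr {h : E → E →L[ℝ] E →L[ℝ] ℝ} {V W W' : E → E} {z : E} (hW : W =ᶠ[𝓝 z] W') :
    covDeriv h V W z = covDeriv h V W' z := by
  rw [covDeriv, covDeriv, hW.fderiv_eq, hW.self_of_nhds]

theorem covDeriv_const_smul {h : E → E →L[ℝ] E →L[ℝ] ℝ} {V W : E → E} {z : E} (c : ℝ)
    (hW : DifferentiableAt ℝ W z) :
    covDeriv h V (fun z' => c • W z') z = c • covDeriv h V W z := by
  rw [covDeriv, covDeriv, fderiv_fun_const_smul hW, ← christoffelCLM_apply, ← christoffelCLM_apply]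
  simp

/-- The curvature tensor of the Levi-Civita connection of `h`, in terms of the Christoffel
symbols. -/
def riemannCoord (h : E → E →L[ℝ] E →L[ℝ] ℝ) (z u v w : E) : E :=
  fderiv ℝ (fun z' => christoffel h z' v w) z u - fderiv ℝ (fun z' => christoffel h z' u w) z v
    + christoffel h z u (christoffel h z v w) - christoffel h z v (christoffel h z u w)

theorem fderiv_christoffel {h : E → E →L[ℝ] E →L[ℝ] ℝ} {z : E}
    (hd : DifferentiableAt ℝ (christoffelCLM h) z) (u v w : E) :
    fderiv ℝ (fun z' => christoffel h z' v w) z u = fderiv ℝ (christoffelCLM h) z u v w := by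
  have := (hd.hasFDerivAt.clm_apply (hasFDerivAt_const v z)).clm_apply (hasFDerivAt_const w z)
  have := this.fderiv
  simp only [christoffelCLM_apply] at this
  rw [this]
  simp

theorem fderiv_covDeriv {h : E → E →L[ℝ] E →L[ℝ] ℝ} {z : E}
    (hd : DifferentiableAt ℝ (christoffelCLM h) z) {V W : E → E}
    (hV : DifferentiableAt ℝ V z) (hW : ContDiffAt ℝ 2 W z) (u : E) :
    fderiv ℝ (covDeriv h V W) z u =
      fderiv ℝ (fderiv ℝ W) z u (V z) + fderiv ℝ W z (fderiv ℝ V z u)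
      + fderiv ℝ (christoffelCLM h) z u (V z) (W z)
      + christoffel h z (fderiv ℝ V z u) (W z) + christoffel h z (V z) (fderiv ℝ W z u) := by
  have hW1 : HasFDerivAt W (fderiv ℝ W z) z := (hW.differentiableAt two_ne_zero).hasFDerivAt
  have h2 : DifferentiableAt ℝ (fderiv ℝ W) z :=
    (hW.fderiv_right (m := 1) (by norm_num)).differentiableAt one_ne_zero
  have := (h2.hasFDerivAt.clm_apply hV.hasFDerivAt).add
    ((hd.hasFDerivAt.clm_apply hV.hasFDerivAt).clm_apply hW1)
  have e : covDeriv h V W = (fun y => (fderiv ℝ W y) (V y)) +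
    fun y => (christoffelCLM h y (V y)) (W y) := rfl
  rw [e, this.fderiv]
  simp only [← christoffelCLM_apply]
  simp
  abel

/-- The curvature tensor is the commutator of covariant derivatives. -/
theorem riemannCoord_eq {h : E → E →L[ℝ] E →L[ℝ] ℝ} {z : E}
    (hd : DifferentiableAt ℝ (christoffelCLM h) z) (hs : ∀ u v, christoffel h z u v
      = christoffel h z v u) {U V W : E → E}
    (hU : DifferentiableAt ℝ U z) (hV : DifferentiableAt ℝ V z) (hW : ContDiffAt ℝ 2 W z) :
    riemannCoord h z (U z) (V z) (W z) =
      covDeriv h U (covDeriv h V W) z - covDeriv h V (covDeriv h U W) z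
        - covDeriv h (lieBracket ℝ U V) W z := by
  have hsymm : fderiv ℝ (fderiv ℝ W) z (U z) (V z) = fderiv ℝ (fderiv ℝ W) z (V z) (U z) :=
    (hW.isSymmSndFDerivAt (by simp)).eq _ _
  have hc : ∀ V W, covDeriv h V W z = fderiv ℝ W z (V z) + christoffel h z (V z) (W z) :=
    fun _ _ => rfl
  simp only [hc, fderiv_covDeriv hd hV hW, fderiv_covDeriv hd hU hW, hsymm, riemannCoord,
    fderiv_christoffel hd, lieBracket]
  simp only [← christoffelCLM_apply] at hs ⊢
  simp only [map_add, map_sub, sub_apply]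
  rw [hs (V z) (fderiv ℝ W z (U z)), hs (U z) (fderiv ℝ W z (V z))]
  abel

/-! ### Killing fields with constant pairings, and their curvature. -/

/-- `V` satisfies the Killing equation of `h` at `z`. -/
def IsKillingAt (h : E → E →L[ℝ] E →L[ℝ] ℝ) (V : E → E) (z : E) : Prop :=
  ∀ u v, fderiv ℝ h z (V z) u v + h z (fderiv ℝ V z u) v + h z u (fderiv ℝ V z v) = 0

theorem fderiv_pairing {h : E → E →L[ℝ] E →L[ℝ] ℝ} {z : E} (hd : DifferentiableAt ℝ h z)
    {V W : E → E} (hV : DifferentiableAt ℝ V z) (hW : DifferentiableAt ℝ W z) (w : E) :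
    fderiv ℝ (fun z' => h z' (V z') (W z')) z w = fderiv ℝ h z w (V z) (W z)
      + h z (fderiv ℝ V z w) (W z) + h z (V z) (fderiv ℝ W z w) := by
  have := (hd.hasFDerivAt.clm_apply hV.hasFDerivAt).clm_apply hW.hasFDerivAt
  rw [this.fderiv]
  simp
  ring

/-- The covariant derivative is half of the Lie bracket for Killing fields with constant
pairings. -/
theorem covDeriv_eq_lieBracket {ι : Type*} {h : E → E →L[ℝ] E →L[ℝ] ℝ} {z : E}
    (hd : DifferentiableAt ℝ h z) (hs : ∀ᶠ z' in 𝓝 z, ∀ u v, h z' u v = h z' v u)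
    (hi : (h z).IsInvertible) (ξ : ι → E → E) (hξ : ∀ i, DifferentiableAt ℝ (ξ i) z)
    (hsurj : ∀ v, ∃ i, ξ i z = v) (hK : ∀ i, IsKillingAt h (ξ i) z)
    (hconst : ∀ i j, ∃ c : ℝ, ∀ᶠ z' in 𝓝 z, h z' (ξ i z') (ξ j z') = c) (i j : ι) :
    covDeriv h (ξ i) (ξ j) z = (1 / 2 : ℝ) • lieBracket ℝ (ξ i) (ξ j) z := by
  have hs0 := hs.self_of_nhds
  have hconst' : ∀ i j w, fderiv ℝ h z w (ξ i z) (ξ j z)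
      + h z (fderiv ℝ (ξ i) z w) (ξ j z) + h z (ξ i z) (fderiv ℝ (ξ j) z w) = 0 := by
    intro i j w
    obtain ⟨c, hc⟩ := hconst i j
    rw [← fderiv_pairing hd (hξ i) (hξ j)]
    have : (fun z' => h z' (ξ i z') (ξ j z')) =ᶠ[𝓝 z] fun _ => c := hc
    rw [this.fderiv_eq]
    simp
  apply hi.injective
  ext v
  obtain ⟨k, rfl⟩ := hsurj v
  rw [covDeriv, map_add, add_apply, christoffel, apply_koszul hi, lieBracket]
  simp only [map_smul, map_sub, smul_apply, sub_apply,
    smul_eq_mul]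
  -- These three relations eliminate the three derivatives of `h` in the Koszul formula tested on `ξ
  -- k`. The derivatives of `ξ k` cancel, leaving `-½ (∂_i ξ_j + ∂_j ξ_i)` paired with `ξ k`; adding
  -- `∂_i ξ_j` gives half the bracket.
  have h1 := hK k (ξ i z) (ξ j z)
  have h2 := hconst' j k (ξ i z)
  have h3 := hconst' i k (ξ j z)
  rw [hs0 (ξ i z)] at h1 h3
  rw [hs0 (ξ j z)] at h2
  linarith

/-- Skew-symmetry of `ad`: subtracting the Killing equation of `V` at `(W, W)` from the vanishing
derivative of `h(W, W)` along `V` leaves twice this pairing. It serves to show that `[[U, Y], Y]` is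
orthogonal to `Y`. -/
theorem lieBracket_pairing_eq_zero {h : E → E →L[ℝ] E →L[ℝ] ℝ} {z : E}
    (hd : DifferentiableAt ℝ h z) (hs : ∀ u v, h z u v = h z v u) {V W : E → E}
    (hW : DifferentiableAt ℝ W z) (hK : IsKillingAt h V z)
    (hconst : ∃ c : ℝ, ∀ᶠ z' in 𝓝 z, h z' (W z') (W z') = c) :
    h z (W z) (lieBracket ℝ V W z) = 0 := by
  obtain ⟨c, hc⟩ := hconst
  have h1 := fderiv_pairing hd hW hW (V z)
  have : (fun z' => h z' (W z') (W z')) =ᶠ[𝓝 z] fun _ => c := hc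
  rw [this.fderiv_eq, fderiv_fun_const] at h1
  have h2 := hK (W z) (W z)
  rw [hs _ (W z)] at h1 h2
  simp only [Pi.zero_apply, zero_apply] at h1
  rw [lieBracket, map_sub]
  linarith

/-- The curvature tensor of `h` in terms of Lie brackets, if the vector fields `ξ i` are Killing
fields with constant pairings that span the tangent spaces. -/
theorem riemannCoord_eq_lieBracket [CompleteSpace E] {ι : Type*} {h : E → E →L[ℝ] E →L[ℝ] ℝ}
    {T : Set E} (hT : IsOpen T)
    (hd : ContDiffOn ℝ 2 h T) (hs : ∀ z ∈ T, ∀ u v, h z u v = h z v u)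
    (hi : ∀ z ∈ T, (h z).IsInvertible) (ξ : ι → E → E) (hξ : ∀ i, ContDiffOn ℝ 2 (ξ i) T)
    (hsurj : ∀ z ∈ T, ∀ v, ∃ i, ξ i z = v) (hK : ∀ z ∈ T, ∀ i, IsKillingAt h (ξ i) z)
    (hconst : ∀ i j, ∃ c : ℝ, ∀ z ∈ T, h z (ξ i z) (ξ j z) = c)
    {i j k l : ι} (hk : ∀ z ∈ T, ξ k z = lieBracket ℝ (ξ i) (ξ j) z)
    {z : E} (hz : z ∈ T) (hl : ξ l z = lieBracket ℝ (ξ k) (ξ j) z) :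
    riemannCoord h z (ξ i z) (ξ j z) (ξ j z) = (-1 / 4 : ℝ) • ξ l z := by
  have hTn : ∀ {z}, z ∈ T → T ∈ 𝓝 z := fun hz => hT.mem_nhds hz
  have cov : ∀ i j, ∀ z ∈ T,
      covDeriv h (ξ i) (ξ j) z = (1 / 2 : ℝ) • lieBracket ℝ (ξ i) (ξ j) z := fun i j z hz =>
    covDeriv_eq_lieBracket ((hd.contDiffAt (hTn hz)).differentiableAt two_ne_zero)
      (eventually_of_mem (hTn hz) hs) (hi z hz) ξ
      (fun i => ((hξ i).contDiffAt (hTn hz)).differentiableAt two_ne_zero) (hsurj z hz)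
      (hK z hz) (fun i j => (hconst i j).imp fun c hc => eventually_of_mem (hTn hz) hc) i j
  have hξd : ∀ i, DifferentiableAt ℝ (ξ i) z := fun i =>
    ((hξ i).contDiffAt (hTn hz)).differentiableAt two_ne_zero
  have hhd := (hd.contDiffAt (hTn hz)).differentiableAt two_ne_zero
  rw [riemannCoord_eq (differentiableAt_christoffelCLM (hd.contDiffAt (hTn hz)) (hi z hz))
    (christoffel_symm hhd (eventually_of_mem (hTn hz) hs)) (hξd i) (hξd j)
    ((hξ j).contDiffAt (hTn hz))]
  -- Zero is written as a multiple of `ξ i` so that `covDeriv_const_smul` treats both inner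
  -- derivatives alike. Equality near `z` is needed because they are differentiated again.
  have e1 : covDeriv h (ξ j) (ξ j) =ᶠ[𝓝 z] fun z' => (0 : ℝ) • ξ i z' :=
    eventually_of_mem (hTn hz) fun z' hz' => by
      simp [cov j j z' hz']
  have e2 : covDeriv h (ξ i) (ξ j) =ᶠ[𝓝 z] fun z' => (1 / 2 : ℝ) • ξ k z' :=
    eventually_of_mem (hTn hz) fun z' hz' => by
      simp [cov i j z' hz', hk z' hz']
  rw [covDeriv_congr e1, covDeriv_congr e2, covDeriv_const_smul _ (hξd _),
    covDeriv_const_smul _ (hξd _), cov j k z hz]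
  have e3 : covDeriv h (lieBracket ℝ (ξ i) (ξ j)) (ξ j) z = covDeriv h (ξ k) (ξ j) z := by
    rw [covDeriv, covDeriv, hk z hz]
  -- What remains is `-¼ [ξ_j, ξ_k] - ½ [ξ_k, ξ_j] = -¼ [ξ_k, ξ_j]`.
  rw [e3, cov k j z hz, lieBracket_swap (V := ξ j), ← hl]
  module

/-- If the Chern connection of `L` has the coefficients of the Levi-Civita connection of `h`, then
they have the same curvature. -/
theorem chernCurvature_eq_riemannCoord {L : E → E → ℝ} {h : E → E →L[ℝ] E →L[ℝ] ℝ} {z y : E}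
    (hz : ∀ᶠ z' in 𝓝 z, ∀ u v, chernCoeff L z' y u v = christoffel h z' u v)
    (hy : ∀ᶠ y' in 𝓝 y, ∀ u v, chernCoeff L z y' u v = christoffel h z u v) (u v w : E) :
    chernCurvature L z y u v w = riemannCoord h z u v w := by
  have h1 : ∀ u v, fderiv ℝ (fun z' => chernCoeff L z' y u v) z
      = fderiv ℝ (fun z' => christoffel h z' u v) z := fun u v =>
    Filter.EventuallyEq.fderiv_eq (hz.mono fun z' h => h u v)
  -- The vertical derivatives vanish, so the nonlinear connection drops out and never has to be
  -- computed.
  have h2 : ∀ u v, fderiv ℝ (fun y' => chernCoeff L z y' u v) y = 0 := fun u v => by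
    have : (fun y' => chernCoeff L z y' u v) =ᶠ[𝓝 y] fun _ => christoffel h z u v :=
      hy.mono fun y' h => h u v
    rw [this.fderiv_eq]
    simp
  have h3 := hz.self_of_nhds
  simp only [chernCurvature, riemannCoord, h1, h2, h3]
  simp

/-! ### Fundamental tensor and flag curvature of a Kropina metric. -/

/-- The fundamental tensor of a Kropina metric. -/
theorem fundTensor_kropina {L : E → E → ℝ} {q : E →L[ℝ] E →L[ℝ] ℝ} {z y x : E}
    (hq : ∀ u v, q u v = q v u) (hL : ∀ y, L z y = q y y / q y x) (hyx : q y x ≠ 0) (u v : E) :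
    fundTensor L z y u v =
      (2 * q y y * q u v + 4 * q y u * q y v) / q y x ^ 2
      - 4 * q y y * (q y u * q v x + q y v * q u x) / q y x ^ 3
      + 3 * q y y ^ 2 * q u x * q v x / q y x ^ 4 := by
  have hF : (fun y' => L z y' ^ 2) = fun y' => (q y' y' / q y' x) ^ 2 := by simp [hL]
  have hcd : ∀ y', q y' x ≠ 0 → ContDiffAt ℝ 2 (fun y' => (q y' y' / q y' x) ^ 2) y' :=
    fun y' hy' => by
    have : ContDiffAt ℝ 2 (fun y' => q y' y') y' := by fun_prop
    have h2 : ContDiffAt ℝ 2 (fun y' => q y' x) y' := by fun_prop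
    exact (this.div h2 hy').pow 2
  -- Both derivatives are computed along lines, by one-variable quotient rules; smoothness
  -- identifies the results with values of the Fréchet derivatives.
  have hline : ∀ y' w : E, (fun t : ℝ => q (y' + t • w) (y' + t • w)) =
      fun t : ℝ => q y' y' + t * (2 * q y' w) + t ^ 2 * q w w := fun y' w => by
    funext t
    simp only [map_add, map_smul, add_apply, smul_apply,
      smul_eq_mul, hq w y']
    ring
  have hline1 : ∀ y' w c : E, (fun t : ℝ => q (y' + t • w) c) =
      fun t : ℝ => q y' c + t * q w c := fun y' w c => by
    funext t
    simp
  have dquad : ∀ y' w : E, HasDerivAt (fun t : ℝ => q (y' + t • w) (y' + t • w))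
      (2 * q y' w) 0 := fun y' w => by
    rw [hline]
    have := (((hasDerivAt_id (0 : ℝ)).mul_const (2 * q y' w)).const_add (q y' y')).add
      (((hasDerivAt_id (0 : ℝ)).pow 2).mul_const (q w w))
    exact (this.congr_deriv (by simp))
  have dlin : ∀ y' w c : E, HasDerivAt (fun t : ℝ => q (y' + t • w) c) (q w c) 0 :=
    fun y' w c => by
    rw [hline1]
    simpa using ((hasDerivAt_id (0 : ℝ)).mul_const (q w c)).const_add (q y' c)
  have hd1 : ∀ y', q y' x ≠ 0 → ∀ w, fderiv ℝ (fun y' => (q y' y' / q y' x) ^ 2) y' w =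
      4 * q y' y' * q y' w / q y' x ^ 2 - 2 * q y' y' ^ 2 * q w x / q y' x ^ 3 := by
    intro y' hy' w
    have a : HasDerivAt (fun t : ℝ => (q (y' + t • w) (y' + t • w) / q (y' + t • w) x) ^ 2)
        (fderiv ℝ (fun y' => (q y' y' / q y' x) ^ 2) y' w) 0 :=
      ((hcd y' hy').differentiableAt two_ne_zero).hasFDerivAt.hasLineDerivAt w
    have b := ((dquad y' w).div (dlin y' w x) (by simpa using hy')).pow 2
    rw [a.unique b]
    simp
    field_simp
    ring
  have hev : ∀ᶠ y' in 𝓝 y, q y' x ≠ 0 := by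
    have : ContinuousAt (fun y' => q y' x) y := by fun_prop
    exact this.eventually_ne hyx
  have h2 : HasFDerivAt (fderiv ℝ (fun y' => (q y' y' / q y' x) ^ 2))
      (fderiv ℝ (fderiv ℝ (fun y' => (q y' y' / q y' x) ^ 2)) y) y :=
    (((hcd y hyx).fderiv_right (m := 1) (by norm_num)).differentiableAt one_ne_zero).hasFDerivAt
  have h3 : HasFDerivAt (fun y' => fderiv ℝ (fun y' => (q y' y' / q y' x) ^ 2) y' v)
      ((fderiv ℝ (fderiv ℝ (fun y' => (q y' y' / q y' x) ^ 2)) y).flip v) y :=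
    (h2.clm_apply (hasFDerivAt_const v y)).congr_fderiv (by ext; simp)
  have h4 : (fun y' => fderiv ℝ (fun y' => (q y' y' / q y' x) ^ 2) y' v) =ᶠ[𝓝 y]
      fun y' => 4 * q y' y' * q y' v / q y' x ^ 2 - 2 * q y' y' ^ 2 * q v x / q y' x ^ 3 :=
    hev.mono fun y' hy' => hd1 y' hy' v
  have a : HasDerivAt (fun t : ℝ => 4 * q (y + t • u) (y + t • u) * q (y + t • u) v /
      q (y + t • u) x ^ 2 - 2 * q (y + t • u) (y + t • u) ^ 2 * q v x / q (y + t • u) x ^ 3)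
      (fderiv ℝ (fderiv ℝ (fun y' => (q y' y' / q y' x) ^ 2)) y u v) 0 :=
    (h3.congr_of_eventuallyEq h4.symm).hasLineDerivAt u
  have hne : q (y + (0 : ℝ) • u) x ≠ 0 := by simpa using hyx
  have b := ((((dquad y u).const_mul 4).mul (dlin y u v)).div ((dlin y u x).pow 2)
      (pow_ne_zero 2 hne)).sub
    (((((dquad y u).pow 2).const_mul 2).mul_const (q v x)).div ((dlin y u x).pow 3)
      (pow_ne_zero 3 hne))
  have : fundTensor L z y u v =
      (1 / 2 : ℝ) * fderiv ℝ (fderiv ℝ (fun y' => (q y' y' / q y' x) ^ 2)) y u v := by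
    rw [fundTensor, hF]
    rfl
  rw [this, a.unique b]
  simp
  field_simp
  ring

/-- The flag curvature in terms of the curvature tensor of the Chern connection, for a Kropina
metric and an orthonormal flag. -/
theorem flagCurvatureCoord_kropina {L : E → E → ℝ} {q : E →L[ℝ] E →L[ℝ] ℝ} {z y x u r : E}
    (hq : ∀ u v, q u v = q v u) (hL : ∀ y, L z y = q y y / q y x) (hyx : 0 < q y x)
    (hyy : q y y = 1) (huu : q u u = 1) (hyu : q y u = 0) (hr : q y r = 0)
    (hR : chernCurvature L z y u y y = (-1 / 4 : ℝ) • r) :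
    flagCurvatureCoord L z y u = (-3 * q u x * q r x - 2 * q y x ^ 2 * q r u) /
      (8 * (q u x / q y x) ^ 2 + 8) := by
  have key := fundTensor_kropina (L := L) hq hL hyx.ne'
  rw [flagCurvatureCoord, hR, map_smul, smul_apply, key, key, key, key]
  simp only [hyy, huu, hyu, hr, smul_eq_mul]
  have h8 : 8 * (q u x / q y x) ^ 2 + 8 ≠ 0 := by positivity
  have hx := hyx.ne'
  have hden : q u x ^ 2 + q y x ^ 2 ≠ 0 := by positivity
  rw [div_eq_div_iff _ h8]
  · field_simp
    ring
  · have : (2 * 1 * 1 + 4 * 1 * 1) / q y x ^ 2 - 4 * 1 * (1 * q y x + 1 * q y x) / q y x ^ 3 +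
        3 * 1 ^ 2 * q y x * q y x / q y x ^ 4 = 1 / q y x ^ 2 := by
      field_simp
      ring
    rw [this]
    -- The Gram determinant of the flag; its positivity justifies clearing the denominator. The
    -- literal zeros and ones are the substituted orthonormality relations.
    have e : 1 / q y x ^ 2 * ((2 * 1 * 1 + 4 * 0 * 0) / q y x ^ 2
        - 4 * 1 * (0 * q u x + 0 * q u x) / q y x ^ 3
        + 3 * 1 ^ 2 * q u x * q u x / q y x ^ 4)
        - ((2 * 1 * 0 + 4 * 1 * 0) / q y x ^ 2 - 4 * 1 * (1 * q u x + 0 * q y x) / q y x ^ 3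
          + 3 * 1 ^ 2 * q y x * q u x / q y x ^ 4) ^ 2
        = 2 * (q u x ^ 2 + q y x ^ 2) / q y x ^ 6 := by
      field_simp
      ring
    rw [e]
    positivity

/-! ### Partial derivatives, and Killing fields from families of isometries. -/

theorem hasFDerivAt_partial_left {F F' H : Type*} [NormedAddCommGroup F] [NormedSpace ℝ F]
    [NormedAddCommGroup F'] [NormedSpace ℝ F'] [NormedAddCommGroup H] [NormedSpace ℝ H]
    {m : F × F' → H} {z : F} {w : F'}
    {m' : F × F' →L[ℝ] H} (hm : HasFDerivAt m m' (z, w)) :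
    HasFDerivAt (fun z' => m (z', w)) (m'.comp (ContinuousLinearMap.inl ℝ F F')) z :=
  HasFDerivAt.comp (g := m) (f := fun z' => (z', w)) z hm (hasFDerivAt_prodMk_left z w)

theorem hasFDerivAt_partial_right {F F' H : Type*} [NormedAddCommGroup F] [NormedSpace ℝ F]
    [NormedAddCommGroup F'] [NormedSpace ℝ F'] [NormedAddCommGroup H] [NormedSpace ℝ H]
    {m : F × F' → H} {z : F} {w : F'}
    {m' : F × F' →L[ℝ] H} (hm : HasFDerivAt m m' (z, w)) :
    HasFDerivAt (fun w' => m (z, w')) (m'.comp (ContinuousLinearMap.inr ℝ F F')) w :=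
  HasFDerivAt.comp (g := m) (f := fun w' => (z, w')) w hm (hasFDerivAt_prodMk_right z w)

theorem fderiv_partial_left {F F' H : Type*} [NormedAddCommGroup F] [NormedSpace ℝ F]
    [NormedAddCommGroup F'] [NormedSpace ℝ F'] [NormedAddCommGroup H] [NormedSpace ℝ H]
    {m : F × F' → H} {z : F} {w : F'}
    (hm : DifferentiableAt ℝ m (z, w)) (u : F) :
    fderiv ℝ (fun z' => m (z', w)) z u = fderiv ℝ m (z, w) (u, 0) := by
  rw [(hasFDerivAt_partial_left hm.hasFDerivAt).fderiv]
  rfl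

theorem fderiv_partial_right {F F' H : Type*} [NormedAddCommGroup F] [NormedSpace ℝ F]
    [NormedAddCommGroup F'] [NormedSpace ℝ F'] [NormedAddCommGroup H] [NormedSpace ℝ H]
    {m : F × F' → H} {z : F} {w : F'}
    (hm : DifferentiableAt ℝ m (z, w)) (u : F') :
    fderiv ℝ (fun w' => m (z, w')) w u = fderiv ℝ m (z, w) (0, u) := by
  rw [(hasFDerivAt_partial_right hm.hasFDerivAt).fderiv]
  rfl

/-- The infinitesimal generator of a family of local isometries is a Killing field. -/
theorem isKillingAt_of_isometries {F : Type*} [NormedAddCommGroup F] [NormedSpace ℝ F]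
    {h : E → E →L[ℝ] E →L[ℝ] ℝ} {z : E} (hd : DifferentiableAt ℝ h z)
    {m : E × F → E} {w₀ : F} (hm : ContDiffAt ℝ 2 m (z, w₀)) (hm0 : ∀ᶠ z' in 𝓝 z, m (z', w₀) = z')
    (hiso : ∀ᶠ w in 𝓝 w₀, ∀ u v, h (m (z, w)) (fderiv ℝ (fun z' => m (z', w)) z u)
      (fderiv ℝ (fun z' => m (z', w)) z v) = h z u v)
    {V : E → E} {η : F} (hV : ∀ᶠ z' in 𝓝 z, V z' = fderiv ℝ (fun w => m (z', w)) w₀ η) :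
    IsKillingAt h V z := by
  have hmd : ∀ᶠ p in 𝓝 (z, w₀), DifferentiableAt ℝ m p :=
    (hm.eventually (by simp)).mono fun p hp => hp.differentiableAt two_ne_zero
  have hinl : Tendsto (fun z' : E => (z', w₀)) (𝓝 z) (𝓝 (z, w₀)) :=
    (Continuous.prodMk_left w₀).tendsto z
  have hinr : Tendsto (fun w : F => (z, w)) (𝓝 w₀) (𝓝 (z, w₀)) :=
    (Continuous.prodMk_right z).tendsto w₀
  have hDm : HasFDerivAt (fderiv ℝ m) (fderiv ℝ (fderiv ℝ m) (z, w₀)) (z, w₀) :=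
    ((hm.fderiv_right (m := 1) (by norm_num)).differentiableAt one_ne_zero).hasFDerivAt
  -- Mixed partials commute: the parameter derivative of the spatial differential of `m` is the
  -- differential of the generator `V`.
  have hsymm : ∀ u : E, fderiv ℝ (fderiv ℝ m) (z, w₀) (u, 0) (0, η) =
      fderiv ℝ (fderiv ℝ m) (z, w₀) (0, η) (u, 0) := fun u =>
    (hm.isSymmSndFDerivAt (by simp)).eq _ _
  have hV' : V =ᶠ[𝓝 z] fun z' => fderiv ℝ m (z', w₀) (0, η) := by
    filter_upwards [hV, hinl.eventually hmd] with z' h1 h2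
    rw [h1, fderiv_partial_right h2]
  have hVd : ∀ u, fderiv ℝ V z u = fderiv ℝ (fderiv ℝ m) (z, w₀) (u, 0) (0, η) := fun u => by
    have := (hasFDerivAt_partial_left hDm).clm_apply
      (hasFDerivAt_const ((0, η) : E × F) z)
    have h2 := this.congr_of_eventuallyEq hV'
    rw [h2.fderiv]
    simp
  have hA0 : ∀ u, fderiv ℝ m (z, w₀) (u, 0) = u := fun u => by
    rw [← fderiv_partial_left hmd.self_of_nhds]
    have : (fun z' => m (z', w₀)) =ᶠ[𝓝 z] id := hm0
    rw [this.fderiv_eq, fderiv_id]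
    rfl
  have hA : ∀ u, HasFDerivAt (fun w => fderiv ℝ m (z, w) (u, 0))
      (((fderiv ℝ (fderiv ℝ m) (z, w₀)).flip (u, 0)).comp (ContinuousLinearMap.inr ℝ E F)) w₀ :=
    fun u => by
    have := (hasFDerivAt_partial_right hDm).clm_apply
      (hasFDerivAt_const ((u, 0) : E × F) w₀)
    refine this.congr_fderiv ?_
    ext
    simp
  intro u v
  have hm' : HasFDerivAt (fun w => m (z, w))
      ((fderiv ℝ m (z, w₀)).comp (ContinuousLinearMap.inr ℝ E F)) w₀ :=
    hasFDerivAt_partial_right hmd.self_of_nhds.hasFDerivAt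
  have hmz : m (z, w₀) = z := hm0.self_of_nhds
  have hh : HasFDerivAt (fun w => h (m (z, w))) _ w₀ :=
    HasFDerivAt.comp (g := h) w₀ (by rw [hmz]; exact hd.hasFDerivAt) hm'
  have htot := (hh.clm_apply (hA u)).clm_apply (hA v)
  have hcst : (fun w => h (m (z, w)) (fderiv ℝ m (z, w) (u, 0)) (fderiv ℝ m (z, w) (v, 0)))
      =ᶠ[𝓝 w₀] fun _ => h z u v := by
    filter_upwards [hiso, hinr.eventually hmd] with w h1 h2
    rw [← fderiv_partial_left h2, ← fderiv_partial_left h2, h1]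
  -- Differentiating the isometry identity at `w₀` along `η` gives the Killing equation.
  have := congrArg (fun A => A η)
    ((hasFDerivAt_const (h z u v) w₀).unique (htot.congr_of_eventuallyEq hcst.symm))
  simp only [zero_apply, add_apply, ContinuousLinearMap.comp_apply, ContinuousLinearMap.flip_apply,
    ContinuousLinearMap.inr_apply, hA0, hmz] at this
  rw [hVd, hVd, hsymm, hsymm, hV'.self_of_nhds]
  linarith

end Coordinates

/-! ### Passing between a manifold and its preferred charts. -/

section Manifold

variable {E : Type*} [NormedAddCommGroup E] [NormedSpace ℝ E]
  {M : Type*} [TopologicalSpace M] [ChartedSpace E M]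

section

variable [IsManifold 𝓘(ℝ, E) ∞ M]

theorem contMDiffAt_extChartAt_symm {x₀ : M} {z : E} (hz : z ∈ (extChartAt 𝓘(ℝ, E) x₀).target) :
    ContMDiffAt 𝓘(ℝ, E) 𝓘(ℝ, E) ∞ (extChartAt 𝓘(ℝ, E) x₀).symm z :=
  (contMDiffOn_extChartAt_symm x₀).contMDiffAt ((isOpen_extChartAt_target x₀).mem_nhds hz)

theorem contMDiffAt_extChartAt_of_mem {x₀ x : M} (hx : x ∈ (extChartAt 𝓘(ℝ, E) x₀).source) :
    ContMDiffAt 𝓘(ℝ, E) 𝓘(ℝ, E) ∞ (extChartAt 𝓘(ℝ, E) x₀) x :=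
  contMDiffAt_extChartAt' (by simpa using hx)

theorem toCoord_ofCoord {x₀ : M} {z : E} (hz : z ∈ (extChartAt 𝓘(ℝ, E) x₀).target) (y : E) :
    toCoord x₀ ((extChartAt 𝓘(ℝ, E) x₀).symm z) (ofCoord x₀ z y) = y := by
  have : IsManifold 𝓘(ℝ, E) 1 M := .of_le (n := ∞) (by norm_cast)
  have := mfderiv_extChartAt_comp_mfderivWithin_extChartAt_symm (I := 𝓘(ℝ, E)) hz
  rw [ModelWithCorners.range_eq_univ, mfderivWithin_univ] at this
  exact congrArg (fun A : E →L[ℝ] E => A y) this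

theorem ofCoord_toCoord {x₀ : M} {z : E} (hz : z ∈ (extChartAt 𝓘(ℝ, E) x₀).target)
    (v : TangentSpace 𝓘(ℝ, E) ((extChartAt 𝓘(ℝ, E) x₀).symm z)) :
    ofCoord x₀ z (toCoord x₀ ((extChartAt 𝓘(ℝ, E) x₀).symm z) v) = v := by
  have : IsManifold 𝓘(ℝ, E) 1 M := .of_le (n := ∞) (by norm_cast)
  have := mfderivWithin_extChartAt_symm_comp_mfderiv_extChartAt (I := 𝓘(ℝ, E)) hz
  rw [ModelWithCorners.range_eq_univ, mfderivWithin_univ] at this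
  exact congrArg (fun A : E →L[ℝ] E => A v) this

theorem isInvertible_ofCoord {x₀ : M} {z : E} (hz : z ∈ (extChartAt 𝓘(ℝ, E) x₀).target) :
    (mfderiv 𝓘(ℝ, E) 𝓘(ℝ, E) (extChartAt 𝓘(ℝ, E) x₀).symm z).IsInvertible := by
  have : IsManifold 𝓘(ℝ, E) 1 M := .of_le (n := ∞) (by norm_cast)
  have := isInvertible_mfderivWithin_extChartAt_symm (I := 𝓘(ℝ, E)) hz
  rwa [ModelWithCorners.range_eq_univ, mfderivWithin_univ] at this

/-- The tangent space at `x₀` is `E` read through the preferred chart at `x₀`, so this chart has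
identity derivative at its centre. -/
theorem ofCoord_self (x₀ : M) (v : E) :
    ofCoord x₀ (extChartAt 𝓘(ℝ, E) x₀ x₀) v = v := by
  have : IsManifold 𝓘(ℝ, E) 1 M := .of_le (n := ∞) (by norm_cast)
  have := mfderivWithin_range_extChartAt_symm (I := 𝓘(ℝ, E)) (x := x₀)
  rw [ModelWithCorners.range_eq_univ, mfderivWithin_univ] at this
  exact congrArg (fun A : E →L[ℝ] E => A v) this

theorem mpullback_extChartAt_symm {x₀ : M} {z : E} (hz : z ∈ (extChartAt 𝓘(ℝ, E) x₀).target)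
    (W : ∀ x : M, TangentSpace 𝓘(ℝ, E) x) :
    mpullback 𝓘(ℝ, E) 𝓘(ℝ, E) (extChartAt 𝓘(ℝ, E) x₀).symm W z =
      toCoord x₀ ((extChartAt 𝓘(ℝ, E) x₀).symm z) (W ((extChartAt 𝓘(ℝ, E) x₀).symm z)) := by
  exact (isInvertible_ofCoord hz).inverse_apply_eq.2 (ofCoord_toCoord hz _).symm

theorem metricCoord_toCoord (g : RiemMetric E M) {x₀ : M} {z : E}
    (hz : z ∈ (extChartAt 𝓘(ℝ, E) x₀).target)
    (v w : TangentSpace 𝓘(ℝ, E) ((extChartAt 𝓘(ℝ, E) x₀).symm z)) :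
    metricCoord g x₀ z (toCoord x₀ _ v) (toCoord x₀ _ w) = g.inner _ v w := by
  change g.inner _ (ofCoord x₀ z (toCoord x₀ _ v)) (ofCoord x₀ z (toCoord x₀ _ w)) = _
  rw [ofCoord_toCoord hz, ofCoord_toCoord hz]

theorem metricCoord_extChartAt_toCoord (g : RiemMetric E M) {x₀ x : M}
    (hx : x ∈ (extChartAt 𝓘(ℝ, E) x₀).source) (v w : TangentSpace 𝓘(ℝ, E) x) :
    metricCoord g x₀ (extChartAt 𝓘(ℝ, E) x₀ x) (toCoord x₀ x v) (toCoord x₀ x w)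
      = g.inner x v w := by
  obtain ⟨z, hz, rfl⟩ : ∃ z ∈ (extChartAt 𝓘(ℝ, E) x₀).target,
      (extChartAt 𝓘(ℝ, E) x₀).symm z = x :=
    ⟨_, (extChartAt 𝓘(ℝ, E) x₀).map_source hx, (extChartAt 𝓘(ℝ, E) x₀).left_inv hx⟩
  rw [(extChartAt 𝓘(ℝ, E) x₀).right_inv hz, metricCoord_toCoord g hz]

theorem metricCoord_symm (g : RiemMetric E M) (x₀ : M) (z u v : E) :
    metricCoord g x₀ z u v = metricCoord g x₀ z v u :=
  g.symm ((extChartAt 𝓘(ℝ, E) x₀).symm z) (ofCoord x₀ z u) (ofCoord x₀ z v)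

theorem inner_congr (g : RiemMetric E M) {x y : M} (h : x = y) (v w : E) :
    g.inner x v w = g.inner y v w := by
  subst h
  rfl

/-- The derivative of a map between manifolds, in preferred charts. -/
theorem fderiv_extChartAt_comp {M' : Type*} [TopologicalSpace M'] [ChartedSpace E M']
    [IsManifold 𝓘(ℝ, E) ∞ M'] {f : M → M'} {x₀ : M} {x₁ : M'} {z : E}
    (hz : z ∈ (extChartAt 𝓘(ℝ, E) x₀).target)
    (hf : MDifferentiableAt 𝓘(ℝ, E) 𝓘(ℝ, E) f ((extChartAt 𝓘(ℝ, E) x₀).symm z))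
    (hfz : f ((extChartAt 𝓘(ℝ, E) x₀).symm z) ∈ (extChartAt 𝓘(ℝ, E) x₁).source) (u : E) :
    fderiv ℝ (fun z' => extChartAt 𝓘(ℝ, E) x₁ (f ((extChartAt 𝓘(ℝ, E) x₀).symm z'))) z u =
      toCoord x₁ (f ((extChartAt 𝓘(ℝ, E) x₀).symm z))
        (mfderiv 𝓘(ℝ, E) 𝓘(ℝ, E) f ((extChartAt 𝓘(ℝ, E) x₀).symm z) (ofCoord x₀ z u)) := by
  have h1 := (contMDiffAt_extChartAt_symm hz).mdifferentiableAt (by simp)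
  have h2 := (contMDiffAt_extChartAt_of_mem hfz).mdifferentiableAt (by simp)
  have h3 := (h2.hasMFDerivAt.comp _ hf.hasMFDerivAt).comp z h1.hasMFDerivAt
  have h4 := h3.mfderiv
  rw [mfderiv_eq_fderiv] at h4
  exact congrArg (fun A : E →L[ℝ] E => A u) h4

theorem isInvertible_metricCoord [FiniteDimensional ℝ E] (g : RiemMetric E M) {x₀ : M} {z : E}
    (hz : z ∈ (extChartAt 𝓘(ℝ, E) x₀).target) : (metricCoord g x₀ z).IsInvertible := by
  refine isInvertible_of_pos fun u hu => g.pos _ _ fun h => hu ?_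
  rw [← toCoord_ofCoord hz u]
  exact (congrArg _ h).trans (map_zero _)

/-- A coordinate field is the tangent map of the inverse chart applied to a constant field.
Contracting the metric with such fields gives its smooth coefficients. -/
theorem contMDiffOn_ofCoord (x₀ : M) (u : E) :
    ContMDiffOn 𝓘(ℝ, E) 𝓘(ℝ, E).tangent ∞
      (fun z => (⟨(extChartAt 𝓘(ℝ, E) x₀).symm z, ofCoord x₀ z u⟩ : TangentBundle 𝓘(ℝ, E) M))
      (extChartAt 𝓘(ℝ, E) x₀).target := by
  have : IsManifold 𝓘(ℝ, E) 1 M := .of_le (n := ∞) (by norm_cast)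
  have ho := isOpen_extChartAt_target (I := 𝓘(ℝ, E)) x₀
  have h1 := ContMDiffOn.contMDiffOn_tangentMapWithin (m := ∞) (n := ∞)
    (contMDiffOn_extChartAt_symm (I := 𝓘(ℝ, E)) x₀) (by norm_cast) ho.uniqueMDiffOn
  have h2 : ContMDiff 𝓘(ℝ, E) 𝓘(ℝ, E).tangent ∞
      (fun z : E => (⟨z, u⟩ : TangentBundle 𝓘(ℝ, E) E)) := fun z =>
    contMDiffAt_vectorSpace_iff_contDiffAt.2 contDiffAt_const
  refine (h1.comp h2.contMDiffOn fun z hz => hz).congr fun z hz => ?_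
  simp only [Function.comp_apply, tangentMapWithin]
  rw [mfderivWithin_of_isOpen ho hz]
  rfl

theorem contDiffOn_metricCoord [FiniteDimensional ℝ E] (g : RiemMetric E M) (x₀ : M) :
    ContDiffOn ℝ ∞ (metricCoord g x₀) (extChartAt 𝓘(ℝ, E) x₀).target := by
  rw [contDiffOn_clm_apply]
  intro u
  rw [contDiffOn_clm_apply]
  intro v
  have hg : ContMDiffOn 𝓘(ℝ, E) (𝓘(ℝ, E).prod 𝓘(ℝ, E →L[ℝ] E →L[ℝ] ℝ)) ∞
      (fun z => TotalSpace.mk' (E →L[ℝ] E →L[ℝ] ℝ)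
        (E := fun x : M => TangentSpace 𝓘(ℝ, E) x →L[ℝ] TangentSpace 𝓘(ℝ, E) x →L[ℝ] ℝ)
        ((extChartAt 𝓘(ℝ, E) x₀).symm z) (g.inner ((extChartAt 𝓘(ℝ, E) x₀).symm z)))
      (extChartAt 𝓘(ℝ, E) x₀).target :=
    g.contMDiff.comp_contMDiffOn (contMDiffOn_extChartAt_symm x₀)
  have h3 := ContMDiffOn.clm_bundle_apply₂ (F₃ := ℝ) (E₃ := Bundle.Trivial M ℝ) hg
    (contMDiffOn_ofCoord x₀ u) (contMDiffOn_ofCoord x₀ v)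
  intro z hz
  have h4 := h3 z hz
  rw [contMDiffWithinAt_totalSpace] at h4
  exact h4.2.contDiffWithinAt

end

end Manifold

/-! ### Left-invariant fields and bi-invariant metrics in charts. -/

section LieGroup

variable {E : Type*} [NormedAddCommGroup E] [NormedSpace ℝ E]
  {G : Type*} [TopologicalSpace G] [ChartedSpace E G] [Group G]

/-- The left-invariant vector field with value `v` at the identity, in the preferred chart
at `a`. -/
def leftInvariantCoord (a : G) (v : GroupLieAlgebra 𝓘(ℝ, E) G) : E → E :=
  mpullback 𝓘(ℝ, E) 𝓘(ℝ, E) (extChartAt 𝓘(ℝ, E) a).symm (mulInvariantVectorField v)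

theorem IsLeftInvariantField.eq_mulInvariantVectorField {V : ∀ x : G, TangentSpace 𝓘(ℝ, E) x}
    (hV : IsLeftInvariantField V) : V = mulInvariantVectorField (V 1) := by
  funext a
  have h := hV a 1
  have hc : ∀ {x y : G}, x = y → (V x : E) = V y := by rintro x y rfl; rfl
  exact ((hc (mul_one a)).symm.trans h.symm :)

variable [LieGroup 𝓘(ℝ, E) ∞ G]

theorem inner_mulInvariantVectorField {g : RiemMetric E G}
    (hg : IsBiInvariant g) (v w : GroupLieAlgebra 𝓘(ℝ, E) G) (a : G) :
    g.inner a (mulInvariantVectorField v a) (mulInvariantVectorField w a) = g.inner 1 v w := by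
  rw [← hg.1 a 1 v w]
  exact inner_congr g (mul_one a).symm _ _

variable (E) in
theorem lieGroup_three : LieGroup 𝓘(ℝ, E) (minSmoothness ℝ 3) G :=
  LieGroup.of_le (n := ∞) (by simp; norm_cast)

theorem leftInvariantCoord_apply {a : G} {z : E} (hz : z ∈ (extChartAt 𝓘(ℝ, E) a).target)
    (v : GroupLieAlgebra 𝓘(ℝ, E) G) :
    leftInvariantCoord a v z = toCoord a ((extChartAt 𝓘(ℝ, E) a).symm z)
      (mulInvariantVectorField v ((extChartAt 𝓘(ℝ, E) a).symm z)) :=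
  mpullback_extChartAt_symm hz _

theorem ofCoord_leftInvariantCoord {a : G} {z : E} (hz : z ∈ (extChartAt 𝓘(ℝ, E) a).target)
    (v : GroupLieAlgebra 𝓘(ℝ, E) G) :
    ofCoord a z (leftInvariantCoord a v z) =
      mulInvariantVectorField v ((extChartAt 𝓘(ℝ, E) a).symm z) := by
  rw [leftInvariantCoord_apply hz, ofCoord_toCoord hz]

theorem leftInvariantCoord_extChartAt (a : G) (v : GroupLieAlgebra 𝓘(ℝ, E) G) :
    leftInvariantCoord a v (extChartAt 𝓘(ℝ, E) a a) = toCoord a a (mulInvariantVectorField v a) := by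
  rw [leftInvariantCoord_apply (mem_extChartAt_target a)]
  have hc : ∀ x, x = a → (toCoord a x (mulInvariantVectorField v x) : E) =
    toCoord a a (mulInvariantVectorField v a) := by rintro x rfl; rfl
  exact hc _ (extChartAt_to_inv a)

theorem contDiffOn_leftInvariantCoord [CompleteSpace E] (a : G) (v : GroupLieAlgebra 𝓘(ℝ, E) G) :
    ContDiffOn ℝ 2 (leftInvariantCoord a v) (extChartAt 𝓘(ℝ, E) a).target := by
  have := lieGroup_three E (G := G)
  have : IsManifold 𝓘(ℝ, E) 1 G := .of_le (n := ∞) (by norm_cast)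
  intro z hz
  have h := contMDiffAt_mulInvariantVectorField v (g := (extChartAt 𝓘(ℝ, E) a).symm z)
  replace h : ContMDiffAt 𝓘(ℝ, E) 𝓘(ℝ, E).tangent 2 _ _ :=
    h.of_le minSmoothness_of_isRCLikeNormedField.ge
  exact (contMDiffAt_vectorSpace_iff_contDiffAt.1
    (h.mpullback_vectorField_preimage (contMDiffAt_extChartAt_symm hz) (isInvertible_ofCoord hz)
      (by norm_cast))).contDiffWithinAt

/-- Brackets commute with pullback by the inverse chart, so the Lie algebra bracket becomes the
bracket of vector fields on `E`. -/
theorem leftInvariantCoord_bracket [CompleteSpace E] {a : G} {z : E}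
    (hz : z ∈ (extChartAt 𝓘(ℝ, E) a).target) (v w : GroupLieAlgebra 𝓘(ℝ, E) G) :
    leftInvariantCoord a ⁅v, w⁆ z =
      lieBracket ℝ (leftInvariantCoord a v) (leftInvariantCoord a w) z := by
  have := lieGroup_three E (G := G)
  have : IsManifold 𝓘(ℝ, E) (minSmoothness ℝ 2) G := .of_le (n := ∞) (by simp; norm_cast)
  rw [leftInvariantCoord, GroupLieAlgebra.bracket_def, mulInvariantVector_mlieBracket,
    mpullback_mlieBracket (n := ∞) (mdifferentiableAt_mulInvariantVectorField _)
      (mdifferentiableAt_mulInvariantVectorField _) (contMDiffAt_extChartAt_symm hz)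
      (by simp; norm_cast), ← mlieBracketWithin_univ, mlieBracketWithin_eq_lieBracketWithin]
  exact congrFun lieBracketWithin_univ z

theorem mulInvariantVectorField_surjective (a : G) (w : TangentSpace 𝓘(ℝ, E) a) :
    ∃ v : GroupLieAlgebra 𝓘(ℝ, E) G, mulInvariantVectorField v a = w := by
  have hd : ∀ b x : G, MDifferentiableAt 𝓘(ℝ, E) 𝓘(ℝ, E) (fun x : G => b * x) x := fun b x =>
    (contMDiff_mul_left (I := 𝓘(ℝ, E)) (n := ∞)).contMDiffAt.mdifferentiableAt (by simp)
  have h1 := mfderiv_comp a (hd a (a⁻¹ * a)) (hd a⁻¹ a)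
  have h2 : (fun x : G => a * x) ∘ (fun x : G => a⁻¹ * x) = id := by
    ext
    simp
  rw [h2, mfderiv_id] at h1
  have hc : ∀ e : G, e = 1 → ∀ w : E,
      (mfderiv 𝓘(ℝ, E) 𝓘(ℝ, E) (fun x : G => a * x) e w : E) =
      mfderiv 𝓘(ℝ, E) 𝓘(ℝ, E) (fun x : G => a * x) 1 w := by
    rintro e rfl w
    rfl
  exact ⟨(mfderiv 𝓘(ℝ, E) 𝓘(ℝ, E) (fun x : G => a⁻¹ * x) a w : E),
    (hc _ (inv_mul_cancel a) _).symm.trans (congrArg (fun A : E →L[ℝ] E => A w) h1.symm)⟩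

theorem metricCoord_leftInvariantCoord {g : RiemMetric E G} (hg : IsBiInvariant g) {a : G} {z : E}
    (hz : z ∈ (extChartAt 𝓘(ℝ, E) a).target) (v w : GroupLieAlgebra 𝓘(ℝ, E) G) :
    metricCoord g a z (leftInvariantCoord a v z) (leftInvariantCoord a w z) = g.inner 1 v w := by
  rw [leftInvariantCoord_apply hz, leftInvariantCoord_apply hz]
  exact (metricCoord_toCoord g hz _ _).trans (inner_mulInvariantVectorField hg v w _)

theorem leftInvariantCoord_surjective {a : G} {z : E} (hz : z ∈ (extChartAt 𝓘(ℝ, E) a).target)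
    (w : E) : ∃ v : GroupLieAlgebra 𝓘(ℝ, E) G, leftInvariantCoord a v z = w := by
  obtain ⟨v, hv⟩ := mulInvariantVectorField_surjective _ (ofCoord a z w)
  refine ⟨v, ?_⟩
  rw [leftInvariantCoord_apply hz, hv]
  exact toCoord_ofCoord hz w

/-- Left-invariant fields generate right translations, which are isometries; this is where right
invariance enters. -/
theorem isKillingAt_leftInvariantCoord [FiniteDimensional ℝ E] {g : RiemMetric E G}
    (hg : IsBiInvariant g) {a : G} {z : E} (hz : z ∈ (extChartAt 𝓘(ℝ, E) a).target)
    (v : GroupLieAlgebra 𝓘(ℝ, E) G) :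
    IsKillingAt (metricCoord g a) (leftInvariantCoord a v) z := by
  have hmul : ∀ b x : G, MDifferentiableAt 𝓘(ℝ, E) 𝓘(ℝ, E) (fun x : G => b * x) x := fun b x =>
    (contMDiff_mul_left (I := 𝓘(ℝ, E)) (n := ∞)).contMDiffAt.mdifferentiableAt (by simp)
  have hmul' : ∀ b x : G, MDifferentiableAt 𝓘(ℝ, E) 𝓘(ℝ, E) (fun x : G => x * b) x := fun b x =>
    (contMDiff_mul_right (I := 𝓘(ℝ, E)) (n := ∞)).contMDiffAt.mdifferentiableAt (by simp)
  have hT := (isOpen_extChartAt_target (I := 𝓘(ℝ, E)) a).mem_nhds hz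
  set w₀ : E := extChartAt 𝓘(ℝ, E) (1 : G) 1 with hw₀
  have hw₀T : w₀ ∈ (extChartAt 𝓘(ℝ, E) (1 : G)).target := mem_extChartAt_target 1
  have hw₀1 : (extChartAt 𝓘(ℝ, E) (1 : G)).symm w₀ = 1 := extChartAt_to_inv 1
  have hsrc : ∀ z' ∈ (extChartAt 𝓘(ℝ, E) a).target, (extChartAt 𝓘(ℝ, E) a).symm z' *
      (extChartAt 𝓘(ℝ, E) (1 : G)).symm w₀ ∈ (extChartAt 𝓘(ℝ, E) a).source := fun z' hz' => by
    rw [hw₀1, mul_one]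
    exact (extChartAt 𝓘(ℝ, E) a).map_target hz'
  -- Multiplication in charts is a family of right translations parametrised by a neighbourhood of
  -- the identity, which avoids flows and the exponential map.
  let m : E × E → E := fun p => extChartAt 𝓘(ℝ, E) a
    ((extChartAt 𝓘(ℝ, E) a).symm p.1 * (extChartAt 𝓘(ℝ, E) (1 : G)).symm p.2)
  have hsymm : ContMDiffAt 𝓘(ℝ, E × E) 𝓘(ℝ, E) ∞ (fun p : E × E =>
      (extChartAt 𝓘(ℝ, E) a).symm p.1 * (extChartAt 𝓘(ℝ, E) (1 : G)).symm p.2) (z, w₀) :=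
    (ContMDiffAt.comp (z, w₀) (contMDiffAt_extChartAt_symm hz)
      contDiff_fst.contMDiff.contMDiffAt).mul
      (ContMDiffAt.comp (z, w₀) (contMDiffAt_extChartAt_symm hw₀T)
        contDiff_snd.contMDiff.contMDiffAt)
  have hm : ContDiffAt ℝ 2 m (z, w₀) :=
    (ContMDiffAt.comp (z, w₀) (contMDiffAt_extChartAt_of_mem (hsrc z hz))
      hsymm).contDiffAt.of_le (by norm_cast)
  have hcont : ContinuousAt (fun w => (extChartAt 𝓘(ℝ, E) a).symm z *
      (extChartAt 𝓘(ℝ, E) (1 : G)).symm w) w₀ :=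
    hsymm.continuousAt.comp (f := fun w => (z, w)) (Continuous.prodMk_right z).continuousAt
  refine isKillingAt_of_isometries (m := m) (w₀ := w₀) (η := (v : E))
    (((contDiffOn_metricCoord g a).contDiffAt hT).differentiableAt (by simp)) hm ?_ ?_ ?_
  · filter_upwards [hT] with z' hz'
    simp only [m, hw₀1, mul_one, (extChartAt 𝓘(ℝ, E) a).right_inv hz']
  · filter_upwards [hcont.eventually ((isOpen_extChartAt_source (I := 𝓘(ℝ, E)) a).mem_nhds
      (hsrc z hz))] with w hw u u'
    have e := fun u => fderiv_extChartAt_comp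
      (f := fun x => x * (extChartAt 𝓘(ℝ, E) (1 : G)).symm w) (x₁ := a) hz (hmul' _ _) hw u
    have e2 := metricCoord_extChartAt_toCoord g hw
      (mfderiv 𝓘(ℝ, E) 𝓘(ℝ, E) (fun x => x * (extChartAt 𝓘(ℝ, E) (1 : G)).symm w)
        ((extChartAt 𝓘(ℝ, E) a).symm z) (ofCoord a z u))
      (mfderiv 𝓘(ℝ, E) 𝓘(ℝ, E) (fun x => x * (extChartAt 𝓘(ℝ, E) (1 : G)).symm w)
        ((extChartAt 𝓘(ℝ, E) a).symm z) (ofCoord a z u'))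
    rw [hg.2] at e2
    simp only [m, e]
    exact e2
  · filter_upwards [hT] with z' hz'
    have e := fderiv_extChartAt_comp
      (f := fun x => (extChartAt 𝓘(ℝ, E) a).symm z' * x) (x₁ := a) hw₀T (hmul _ _)
      (hsrc z' hz') v
    rw [leftInvariantCoord_apply hz']
    simp only [m]
    refine Eq.trans ?_ (e.trans (congrArg (fun u : E => (toCoord a
      ((extChartAt 𝓘(ℝ, E) a).symm z' * (extChartAt 𝓘(ℝ, E) (1 : G)).symm w₀)
      (mfderiv 𝓘(ℝ, E) 𝓘(ℝ, E) (fun x => (extChartAt 𝓘(ℝ, E) a).symm z' * x)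
        ((extChartAt 𝓘(ℝ, E) (1 : G)).symm w₀) u) : E)) (ofCoord_self (E := E) (1 : G) v))).symm
    -- The base points `x * 1` and `x` are only propositionally equal; these transports use that
    -- every tangent space is `E` by definition.
    have hc : ∀ x y : G, x = y → ∀ A : E, (toCoord a x A : E) = toCoord a y A := by
      rintro x y rfl A
      rfl
    have hc' : ∀ x e : G, e = 1 → (toCoord a (x * e)
        (mfderiv 𝓘(ℝ, E) 𝓘(ℝ, E) (fun y : G => x * y) e v) : E) =
        toCoord a x (mulInvariantVectorField v x) := by
      rintro x e rfl
      exact hc _ _ (mul_one x) _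
    exact (hc' _ _ hw₀1).symm

theorem finslerCoord_kropina {g : RiemMetric E G} {a : G} {z : E}
    (hz : z ∈ (extChartAt 𝓘(ℝ, E) a).target) (X : GroupLieAlgebra 𝓘(ℝ, E) G) (y : E) :
    finslerCoord (kropina g (mulInvariantVectorField X)) a z y =
      metricCoord g a z y y / metricCoord g a z y (leftInvariantCoord a X z) := by
  have h1 : alpha g _ (ofCoord a z y) ^ 2 = metricCoord g a z y y := by
    refine Real.sq_sqrt ?_
    by_cases h : ofCoord a z y = 0
    · rw [h, map_zero]
    · exact (g.pos _ _ h).le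
  have h2 : beta g (mulInvariantVectorField X) _ (ofCoord a z y) =
      metricCoord g a z y (leftInvariantCoord a X z) := by
    rw [beta, ← ofCoord_leftInvariantCoord hz]
    rfl
  rw [finslerCoord, kropina, h1, h2]

theorem ofCoord_mem_kropinaDomain {g : RiemMetric E G} {a : G} {z : E}
    (hz : z ∈ (extChartAt 𝓘(ℝ, E) a).target) {X : GroupLieAlgebra 𝓘(ℝ, E) G} {y : E}
    (hy : 0 < metricCoord g a z y (leftInvariantCoord a X z)) :
    ofCoord a z y ∈ kropinaDomain g (mulInvariantVectorField X) _ := by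
  change 0 < g.inner _ _ _
  rw [← ofCoord_leftInvariantCoord hz]
  exact hy

end LieGroup

end Kropina

end

/-! ### The flag curvature formula. -/

theorem theorem3 {E : Type*} [NormedAddCommGroup E] [NormedSpace ℝ E] [FiniteDimensional ℝ E]
    {G : Type*} [TopologicalSpace G] [ChartedSpace E G] [Group G] [LieGroup 𝓘(ℝ, E) ∞ G]
    (g : Kropina.RiemMetric E G) (hg : Kropina.IsBiInvariant g)
    (V : ∀ x : G, TangentSpace 𝓘(ℝ, E) x) (hV : Kropina.IsLeftInvariantField V)
    (hF : Kropina.ChernEqLeviCivita (Kropina.kropina g V) (Kropina.kropinaDomain g V) g)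
    (Y U X : GroupLieAlgebra 𝓘(ℝ, E) G) (hX : X = V 1)
    (hY : g.inner 1 Y Y = 1) (hU : g.inner 1 U U = 1) (hYU : g.inner 1 Y U = 0)
    (hYX : 0 < g.inner 1 Y X) (a : G) :
    Kropina.flagCurvature (Kropina.kropina g V) a
        (mulInvariantVectorField Y a) (mulInvariantVectorField U a) =
      (-3 * g.inner 1 U X * g.inner 1 ⁅⁅U, Y⁆, Y⁆ X
          - 2 * g.inner 1 Y X ^ 2 * g.inner 1 ⁅⁅U, Y⁆, Y⁆ U) /
        (8 * (g.inner 1 U X / g.inner 1 Y X) ^ 2 + 8) := by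
  open Kropina Filter Topology in
  have hcomplete : CompleteSpace E := FiniteDimensional.complete ℝ E
  have hVX : V = mulInvariantVectorField X := by rw [hX]; exact hV.eq_mulInvariantVectorField
  rw [hVX] at hF ⊢
  clear hX hVX hV
  have hT : IsOpen (extChartAt 𝓘(ℝ, E) a).target := isOpen_extChartAt_target a
  have hz : extChartAt 𝓘(ℝ, E) a a ∈ (extChartAt 𝓘(ℝ, E) a).target := mem_extChartAt_target a
  have hpair := fun v w => metricCoord_leftInvariantCoord hg hz v w
  have hh : ContDiffOn ℝ 2 (metricCoord g a) (extChartAt 𝓘(ℝ, E) a).target :=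
    (contDiffOn_metricCoord g a).of_le (by norm_cast)
  have hξ := fun v : GroupLieAlgebra 𝓘(ℝ, E) G => contDiffOn_leftInvariantCoord a v
  have hR := riemannCoord_eq_lieBracket hT hh (fun z _ => metricCoord_symm g a z)
    (fun z hz => isInvertible_metricCoord g hz) (leftInvariantCoord a) hξ
    (fun z hz => leftInvariantCoord_surjective hz)
    (fun z hz v => isKillingAt_leftInvariantCoord hg hz v)
    (fun v w => ⟨_, fun z hz => metricCoord_leftInvariantCoord hg hz v w⟩)
    (fun z hz => leftInvariantCoord_bracket hz U Y) hz (leftInvariantCoord_bracket hz ⁅U, Y⁆ Y)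
  have horth := lieBracket_pairing_eq_zero
    ((hh.contDiffAt (hT.mem_nhds hz)).differentiableAt two_ne_zero) (metricCoord_symm g a _)
    (((hξ Y).contDiffAt (hT.mem_nhds hz)).differentiableAt two_ne_zero)
    (isKillingAt_leftInvariantCoord hg hz ⁅U, Y⁆)
    ⟨_, eventually_of_mem (hT.mem_nhds hz) fun z hz => metricCoord_leftInvariantCoord hg hz Y Y⟩
  rw [← leftInvariantCoord_bracket hz] at horth
  have hβ : 0 < metricCoord g a (extChartAt 𝓘(ℝ, E) a a)
      (leftInvariantCoord a Y (extChartAt 𝓘(ℝ, E) a a))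
      (leftInvariantCoord a X (extChartAt 𝓘(ℝ, E) a a)) := by rwa [hpair]
  -- The two side goals ask for equal coefficients near the point with the flagpole coordinates
  -- frozen, and near the flagpole at the fixed point. Both hold because `β > 0` is an open
  -- condition.
  rw [← chernCurvature_eq_riemannCoord
    (L := finslerCoord (kropina g (mulInvariantVectorField X)) a)
    (y := leftInvariantCoord a Y (extChartAt 𝓘(ℝ, E) a a)) ?_ ?_] at hR
  · have key := flagCurvatureCoord_kropina (metricCoord_symm g a _) (finslerCoord_kropina hz X) hβ
      ((hpair Y Y).trans hY) ((hpair U U).trans hU) ((hpair Y U).trans hYU) horth hR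
    simp only [hpair] at key
    rw [← key, leftInvariantCoord_extChartAt, leftInvariantCoord_extChartAt]
    rfl
  · have hc : ContinuousAt (fun z => metricCoord g a z
        (leftInvariantCoord a Y (extChartAt 𝓘(ℝ, E) a a)) (leftInvariantCoord a X z))
        (extChartAt 𝓘(ℝ, E) a a) :=
      ((hh.contDiffAt (hT.mem_nhds hz)).continuousAt.clm_apply continuousAt_const).clm_apply
        ((hξ X).contDiffAt (hT.mem_nhds hz)).continuousAt
    filter_upwards [hT.mem_nhds hz, hc.eventually (lt_mem_nhds hβ)] with z hz hpos
    exact hF a z hz _ (ofCoord_mem_kropinaDomain hz hpos)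
  · have hc : ContinuousAt (fun y => metricCoord g a (extChartAt 𝓘(ℝ, E) a a) y
        (leftInvariantCoord a X (extChartAt 𝓘(ℝ, E) a a)))
        (leftInvariantCoord a Y (extChartAt 𝓘(ℝ, E) a a)) := by fun_prop
    filter_upwards [hc.eventually (lt_mem_nhds hβ)] with y hpos
    exact hF a _ hz y (ofCoord_mem_kropinaDomain hz hpos)
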